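/- Let $d\ge 1$ and $\hbar>0$. For $g\in\mathcal S(\mathbb R^d)\setminus\{0\}$ and $f\in\mathcal S'(\mathbb R^d)$ let $V_gf(x,\xi)=(2\pi\hbar)^{-d/2}\,\big\langle f,\ e^{-\frac{i}{\hbar}\xi\cdot y}\,\overline{g(y-x)}\big\rangle$ (the bilinear pairing in the variable $y$) be the short-time Fourier transform of $f$, and let $M^{\infty,1}(\mathbb R^d)$ (the Sjöstrand class) be the set of all $f\in\mathcal S'(\mathbb R^d)$ such that $\int_{\mathbb R^d}\sup_{x\in\mathbb R^d}|V_gf(x,\xi)|\,d\xi<\infty$ for some $g\in\mathcal S(\mathbb R^d)\setminus\{0\}$. Let $C_b^\infty(\mathbb R^d)$ be the space of smooth functions $\mathbb R^d\to\mathbb C$ that are bounded together with their derivatives of every order, and let $\mathcal{FM}(\mathbb R^d)$ be the space of functions of the form $x\mapsto\int_{\mathbb R^d}e^{i\xi\cdot x}\,d\mu(\xi)$, where $\mu$ is a (finite) complex Borel measure on $\mathbb R^d$. Bounded continuous functions are identified with the tempered distributions that they define. Then: 1. the function $x\mapsto\cos|x|$ belongs to $C_b^\infty(\mathbb R^d)$,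 and $C_b^\infty(\mathbb R^d)\subseteq M^{\infty,1}(\mathbb R^d)$; 2. if $d>1$, then the function $x\mapsto\cos|x|$ does not belong to $\mathcal{FM}(\mathbb R^d)$, and $\mathcal{FM}(\mathbb R^d)$ is a proper subset of $M^{\infty,1}(\mathbb R^d)$: $\ \mathcal{FM}(\mathbb R^d)\subsetneq M^{\infty,1}(\mathbb R^d)$. -/

import Mathlib

open scoped SchwartzMap BoundedContinuousFunction ENNReal ContDiff

noncomputable section

namespace Sjostrand

/-- The Euclidean space `ℝ^d`. -/
abbrev E (d : ℕ) : Type := EuclideanSpace ℝ (Fin d)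

/-! ### Short-time Fourier transform and the Sjöstrand class -/

/-- The modulation factor `y ↦ (2πħ)^{-d/2} e^{(i/ħ) ξ·y}`. -/
def modulation {d : ℕ} (ħ : ℝ) (ξ : E d) (y : E d) : ℂ :=
  (((2 * Real.pi * ħ) ^ (-(d : ℝ) / 2) : ℝ) : ℂ) *
    Complex.exp (((inner ℝ ξ y / ħ : ℝ) : ℂ) * Complex.I)

theorem hasTemperateGrowth_cexp_mul_I :
    (fun t : ℝ => Complex.exp ((t : ℂ) * Complex.I)).HasTemperateGrowth := by
  have key : ∀ n : ℕ, iteratedDeriv n (fun t : ℝ => Complex.exp ((t : ℂ) * Complex.I)) =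
      fun t : ℝ => Complex.I ^ n * Complex.exp ((t : ℂ) * Complex.I) := by
    intro n
    induction n with
    | zero => simp
    | succ n ih =>
      rw [iteratedDeriv_succ, ih]
      funext t
      have h1 : HasDerivAt (fun t : ℝ => (t : ℂ) * Complex.I) Complex.I t := by
        simpa using (Complex.ofRealCLM.hasDerivAt (x := t)).mul_const Complex.I
      have h2 := (h1.cexp.const_mul (Complex.I ^ n)).deriv
      rw [h2]
      ring
  refine ⟨((Complex.ofRealCLM.contDiff).mul contDiff_const).cexp, fun n => ⟨0, 1, fun t => ?_⟩⟩
  rw [norm_iteratedFDeriv_eq_norm_iteratedDeriv, key]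
  simp [Complex.norm_exp_ofReal_mul_I]

theorem modulation_hasTemperateGrowth {d : ℕ} (ħ : ℝ) (ξ : E d) :
    (modulation ħ ξ).HasTemperateGrowth := by
  have h1 : (fun y : E d => inner ℝ ξ y / ħ).HasTemperateGrowth := by
    have := (Function.hasTemperateGrowth_inner_right ξ).mul
      (Function.HasTemperateGrowth.const (E := E d) (ħ⁻¹ : ℝ))
    simpa [div_eq_mul_inv, Pi.mul_def] using this
  have h2 := hasTemperateGrowth_cexp_mul_I.comp h1
  exact (Function.HasTemperateGrowth.const
    (E := E d) (((2 * Real.pi * ħ) ^ (-(d : ℝ) / 2) : ℝ) : ℂ)).mul h2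

/-- The phase space shift `π(x, ξ) g = M_ξ T_x g` of a Schwartz function `g`. -/
def phaseShift {d : ℕ} (ħ : ℝ) (x ξ : E d) (g : 𝓢(E d, ℂ)) : 𝓢(E d, ℂ) :=
  SchwartzMap.smulLeftCLM ℂ (modulation ħ ξ) (SchwartzMap.compSubConstCLM ℂ x g)

theorem phaseShift_apply {d : ℕ} (ħ : ℝ) (x ξ : E d) (g : 𝓢(E d, ℂ)) (y : E d) :
    phaseShift ħ x ξ g y = modulation ħ ξ y * g (y - x) := by
  simp [phaseShift, SchwartzMap.smulLeftCLM_apply_apply (modulation_hasTemperateGrowth ħ ξ)]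

/-- The complex conjugate of a Schwartz function. -/
def conjSchwartz {d : ℕ} (g : 𝓢(E d, ℂ)) : 𝓢(E d, ℂ) :=
  SchwartzMap.postcompCLM (𝕜 := ℝ) (Complex.conjCLE : ℂ →L[ℝ] ℂ) g

theorem conjSchwartz_apply {d : ℕ} (g : 𝓢(E d, ℂ)) (y : E d) :
    conjSchwartz g y = (starRingEnd ℂ) (g y) := rfl

/-- The short-time Fourier transform
`V_g f (x, ξ) = ⟨f, π(x, ξ) g⟩ = f (conj (π(x, ξ) g)) = 𝓕 (f · conj (T_x g)) (ξ)`
of a tempered distribution `f` with window `g`. -/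
def stft {d : ℕ} (ħ : ℝ) (g : 𝓢(E d, ℂ)) (f : 𝓢'(E d, ℂ)) (x ξ : E d) : ℂ :=
  f (conjSchwartz (phaseShift ħ x ξ g))

/-- The (possibly infinite) norm `∫ sup_x |V_g f (x, ξ)| dξ`. -/
def sjostrandNorm {d : ℕ} (ħ : ℝ) (g : 𝓢(E d, ℂ)) (f : 𝓢'(E d, ℂ)) : ℝ≥0∞ :=
  ∫⁻ ξ : E d, ⨆ x : E d, ‖stft ħ g f x ξ‖ₑ

/-- The Sjöstrand class `M^{∞,1}(ℝ^d)`. -/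
def sjostrandClass (ħ : ℝ) (d : ℕ) : Set (𝓢'(E d, ℂ)) :=
  {f | ∃ g : 𝓢(E d, ℂ), g ≠ 0 ∧ sjostrandNorm ħ g f < ⊤}

/-! ### Bounded continuous functions as tempered distributions -/

theorem memLp_top {d : ℕ} (f : E d →ᵇ ℂ) :
    MeasureTheory.MemLp f (⊤ : ℝ≥0∞) (MeasureTheory.volume : MeasureTheory.Measure (E d)) :=
  MeasureTheory.memLp_top_of_bound f.continuous.aestronglyMeasurable ‖f‖
    (Filter.Eventually.of_forall f.norm_coe_le_norm)

/-- The tempered distribution `φ ↦ ∫ φ(y) f(y) dy` defined by a bounded continuous function. -/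
def toDistribution {d : ℕ} (f : E d →ᵇ ℂ) : 𝓢'(E d, ℂ) :=
  MeasureTheory.Lp.toTemperedDistribution ((memLp_top f).toLp f)

theorem toDistribution_apply {d : ℕ} (f : E d →ᵇ ℂ) (φ : 𝓢(E d, ℂ)) :
    toDistribution f φ = ∫ y : E d, φ y * f y := by
  rw [toDistribution, MeasureTheory.Lp.toTemperedDistribution_apply]
  refine MeasureTheory.integral_congr_ae ?_
  filter_upwards [(memLp_top f).coeFn_toLp] with y hy
  rw [hy, smul_eq_mul]

/-- The space `C_b^∞(ℝ^d)` of smooth functions that are bounded with all their derivatives. -/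
def CbInfty (d : ℕ) : Set (E d →ᵇ ℂ) :=
  {f | ContDiff ℝ ∞ f ∧ ∀ n : ℕ, ∃ C : ℝ, ∀ x : E d, ‖iteratedFDeriv ℝ n f x‖ ≤ C}

/-- The function `x ↦ cos |x|`. -/
def cosNorm (d : ℕ) : E d →ᵇ ℂ :=
  BoundedContinuousFunction.ofNormedAddCommGroup
    (fun x : E d => ((Real.cos ‖x‖ : ℝ) : ℂ)) (by fun_prop) 1
    (fun x => by
      rw [Complex.norm_real, Real.norm_eq_abs]
      exact Real.abs_cos_le_one _)

/-! ### Fourier transforms of complex measures -/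

open MeasureTheory in
/-- The total variation of a complex measure is finite. -/
theorem isFiniteMeasure_variation {X : Type*} [MeasurableSpace X] (μ : ComplexMeasure X) :
    IsFiniteMeasure μ.variation := by
  have hle : μ.variation ≤ (ComplexMeasure.re μ).totalVariation +
      (ComplexMeasure.im μ).totalVariation := by
    refine VectorMeasure.variation_le_of_forall_enorm_le fun s _ => ?_
    have h : ‖μ s‖ₑ ≤ ‖(μ s).re‖ₑ + ‖(μ s).im‖ₑ := by
      have := Complex.norm_le_abs_re_add_abs_im (μ s)
      rw [← ofReal_norm, ← ofReal_norm, ← ofReal_norm,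
        ← ENNReal.ofReal_add (norm_nonneg _) (norm_nonneg _)]
      exact ENNReal.ofReal_le_ofReal this
    refine h.trans (add_le_add ?_ ?_)
    · exact SignedMeasure.enorm_le_totalVariation (ComplexMeasure.re μ) s
    · exact SignedMeasure.enorm_le_totalVariation (ComplexMeasure.im μ) s
  have : IsFiniteMeasure (ComplexMeasure.re μ).totalVariation := by
    unfold SignedMeasure.totalVariation; infer_instance
  have : IsFiniteMeasure (ComplexMeasure.im μ).totalVariation := by
    unfold SignedMeasure.totalVariation; infer_instance
  exact isFiniteMeasure_of_le _ hle

/-- The function `x ↦ ∫ e^{i ξ·x} dμ(ξ)`. -/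
def fourierIntegral {d : ℕ} (μ : MeasureTheory.ComplexMeasure (E d)) (x : E d) : ℂ :=
  MeasureTheory.VectorMeasure.integral μ
    (fun ξ : E d => Complex.exp (((inner ℝ ξ x : ℝ) : ℂ) * Complex.I))
    (ContinuousLinearMap.mul ℝ ℂ)

theorem fourierIntegral_continuous {d : ℕ} (μ : MeasureTheory.ComplexMeasure (E d)) :
    Continuous (fourierIntegral μ) := by
  have := isFiniteMeasure_variation μ
  refine MeasureTheory.VectorMeasure.continuous_of_dominated (bound := fun _ => 1) ?_ ?_ ?_ ?_
  · intro x
    exact Continuous.aestronglyMeasurable (by fun_prop)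
  · intro x
    exact Filter.Eventually.of_forall fun ξ => (Complex.norm_exp_ofReal_mul_I _).le
  · exact MeasureTheory.integrable_const _
  · exact Filter.Eventually.of_forall fun ξ => by fun_prop

theorem fourierIntegral_bounded {d : ℕ} (μ : MeasureTheory.ComplexMeasure (E d)) :
    ∃ C : ℝ, ∀ x : E d, ‖fourierIntegral μ x‖ ≤ C := by
  have := isFiniteMeasure_variation μ
  exact ⟨_, fun x => MeasureTheory.VectorMeasure.norm_integral_le_of_norm_le_const
    (Filter.Eventually.of_forall fun ξ => (Complex.norm_exp_ofReal_mul_I _).le)⟩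

/-- The Fourier transform `x ↦ ∫ e^{i ξ·x} dμ(ξ)` of a complex measure, as a bounded
continuous function. -/
def fourierMeasure {d : ℕ} (μ : MeasureTheory.ComplexMeasure (E d)) : E d →ᵇ ℂ :=
  BoundedContinuousFunction.ofNormedAddCommGroup (fourierIntegral μ)
    (fourierIntegral_continuous μ) _ (fourierIntegral_bounded μ).choose_spec

/-- The space `𝓕𝓜(ℝ^d)` of Fourier transforms of complex Borel measures on `ℝ^d`. -/
def FM (d : ℕ) : Set (E d →ᵇ ℂ) := Set.range fourierMeasure

end Sjostrand

end

/-! Since `cos` is even, `cos ‖x‖` is a smooth function of `‖x‖ ^ 2`. Near the origin its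
derivatives are bounded by compactness; away from it those of the norm are bounded by homogeneity,
and the chain rule concludes.

Up to a phase and a rescaling, `V_g f (x, ·)` is the Fourier transform of `f(· + x) conj(g)`
(`norm_stft_toDistribution`), so membership in the Sjöstrand class follows from an integrable bound
on these transforms that is uniform in `x`. For `f ∈ C_b^∞` the windowed translates stay bounded in
Schwartz space, hence their transforms decay uniformly. For the transform of a measure, the
translation only inserts a unimodular factor into a convolution of `μ` with a Schwartz function, so
`x` disappears from the bound.

Suppose `cos ‖x‖` were the transform of `μ`. Translating far along a unit vector `e` turns it into
`cos (x · e)` and multiplies `μ` by unimodular factors only. Testing against the trigonometric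
polynomials `((1 + e^{i(ξ·v - c)}) / 2) ^ n`, which tend to the indicator of `A_c = {ξ·v ∈ c +
2πℤ}`, shows that a finite measure `ν` controlling `μ` has mass at least `1/2` on `A_c`, where `c =
v · e`. When `d > 1`, rotating `e` realises every `c ∈ (0, 1)`, and uncountably many disjoint sets
would have positive `ν`-measure. -/

/-! ### The function `cos ‖x‖` -/

/-- The entire function `t ↦ ∑ (-1)ⁿ tⁿ / (2n)!` extends `cos ∘ √` smoothly to the real line. -/
theorem exists_contDiff_comp_sq_eq_cos :
    ∃ h : ℝ → ℝ, ContDiff ℝ ∞ h ∧ ∀ t, h (t ^ 2) = Real.cos t := by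
  let c : ℕ → ℝ := fun n => (-1) ^ n / ((2 * n).factorial : ℝ)
  have hrad : (FormalMultilinearSeries.ofScalars ℝ c).radius = ⊤ := by
    refine FormalMultilinearSeries.ofScalars_radius_eq_top_of_tendsto ℝ c
      (Filter.Eventually.of_forall fun n => by positivity) ?_
    -- Consecutive coefficients have ratio `1 / ((2n + 1)(2n + 2))` in absolute value, which is at
    -- most `1 / (n + 1)`.
    have hlim : Filter.Tendsto (fun n : ℕ => 1 / ((n : ℝ) + 1)) Filter.atTop (nhds 0) :=
      tendsto_one_div_add_atTop_nhds_zero_nat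
    refine squeeze_zero (fun n => by positivity) (fun n => ?_) hlim
    have h2 : (2 * n.succ).factorial = (2 * n + 2) * ((2 * n + 1) * (2 * n).factorial) := by
      rw [show 2 * n.succ = (2 * n + 1) + 1 by omega, Nat.factorial_succ, Nat.factorial_succ]
    have h3 : (0 : ℝ) < ((2 * n).factorial : ℝ) := by positivity
    simp only [c, norm_div, norm_pow, norm_neg, norm_one, one_pow, h2, RCLike.norm_natCast]
    push_cast
    rw [div_div_eq_mul_div, div_one, one_div_mul_eq_div,
      div_le_div_iff₀ (by positivity) (by positivity)]
    nlinarith [mul_nonneg h3.le (Nat.cast_nonneg (α := ℝ) n),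
      mul_nonneg (mul_nonneg h3.le (Nat.cast_nonneg (α := ℝ) n)) (Nat.cast_nonneg (α := ℝ) n)]
  refine ⟨(FormalMultilinearSeries.ofScalars ℝ c).sum, ?_, fun t => ?_⟩
  · have h := (FormalMultilinearSeries.ofScalars ℝ c).hasFPowerSeriesOnBall (by simp [hrad])
    rw [hrad] at h
    refine AnalyticOnNhd.contDiff fun x _ => h.analyticAt_of_mem ?_
    simp
  · have h : (FormalMultilinearSeries.ofScalars ℝ c).sum (t ^ 2) = ∑' n, c n • (t ^ 2) ^ n :=
      FormalMultilinearSeries.ofScalars_sum_eq c (t ^ 2)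
    rw [h, Real.cos_eq_tsum]
    congr 1
    ext n
    simp only [c, smul_eq_mul, ← pow_mul]
    ring

section Norm

variable {V : Type*} [NormedAddCommGroup V] [InnerProductSpace ℝ V]

theorem contDiff_cos_norm : ContDiff ℝ ∞ (fun x : V => Real.cos ‖x‖) := by
  obtain ⟨h, hh, heq⟩ := exists_contDiff_comp_sq_eq_cos
  have : (fun x : V => Real.cos ‖x‖) = h ∘ fun x => ‖x‖ ^ 2 := by
    ext x; simp [heq]
  rw [this]
  exact hh.comp (contDiff_norm_sq ℝ)

/-- The derivatives of the norm are homogeneous of degree `1 - n`. -/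
theorem pow_mul_norm_iteratedFDeriv_norm {t : ℝ} (ht : 0 < t) (n : ℕ) {x : V} (hx : x ≠ 0) :
    t ^ n * ‖iteratedFDeriv ℝ n (fun y : V => ‖y‖) (t • x)‖ =
      t * ‖iteratedFDeriv ℝ n (fun y : V => ‖y‖) x‖ := by
  have hsmooth : ∀ z : V, z ≠ 0 → ContDiffAt ℝ n (fun y : V => ‖y‖) z := fun z hz =>
    contDiffAt_norm ℝ hz
  -- The identity `‖t • y‖ = t * ‖y‖` is differentiated `n` times, the dilation contributing `t ^ n`
  -- on the left.
  let e : V ≃L[ℝ] V := ContinuousLinearEquiv.smulLeft (Units.mk0 t ht.ne')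
  have he : ∀ y, e y = t • y := fun y => rfl
  have h1 : (fun y : V => ‖y‖) ∘ e = fun y => t • ‖y‖ := by
    ext y
    simp [he, norm_smul, abs_of_pos ht]
  have h2 := e.iteratedFDerivWithin_comp_right (fun y : V => ‖y‖) uniqueDiffOn_univ
    (x := x) (Set.mem_univ _) n
  rw [Set.preimage_univ, iteratedFDerivWithin_univ, iteratedFDerivWithin_univ, h1,
    iteratedFDeriv_const_smul_apply' (hsmooth x hx)] at h2
  have h3 : (iteratedFDeriv ℝ n (fun y : V => ‖y‖) (e x)).compContinuousLinearMap
      (fun _ => (e : V →L[ℝ] V)) = t ^ n • iteratedFDeriv ℝ n (fun y : V => ‖y‖) (t • x) := by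
    ext v
    simp [he, ContinuousMultilinearMap.map_smul_univ]
  rw [h3] at h2
  have h4 := congrArg norm h2
  rw [norm_smul, norm_smul, norm_pow, Real.norm_of_nonneg ht.le] at h4
  exact h4.symm

variable [FiniteDimensional ℝ V]

/-- Homogeneity reduces the bound to the compact unit sphere, at the cost of a factor `‖x‖ ^ (1 -
n)`. This is at most `1` because `n ≥ 1`; the norm itself is unbounded in general. -/
theorem exists_norm_iteratedFDeriv_norm_le (n : ℕ) (hn : 1 ≤ n) :
    ∃ C : ℝ, ∀ x : V, 1 ≤ ‖x‖ → ‖iteratedFDeriv ℝ n (fun y : V => ‖y‖) x‖ ≤ C := by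
  have hcont : ContinuousOn (iteratedFDeriv ℝ n (fun y : V => ‖y‖)) (Metric.sphere 0 1) := by
    intro x hx
    have hx0 : x ≠ 0 := by rintro rfl; simp at hx
    exact ((contDiffAt_norm ℝ hx0 (n := n)).continuousAt_iteratedFDeriv le_rfl).continuousWithinAt
  obtain ⟨C, hC⟩ := (isCompact_sphere (0 : V) 1).exists_bound_of_continuousOn hcont
  refine ⟨C, fun x hx => ?_⟩
  have hx0 : 0 < ‖x‖ := by linarith
  have hu : ‖‖x‖⁻¹ • x‖ = 1 := by
    rw [norm_smul, norm_inv, norm_norm, inv_mul_cancel₀ hx0.ne']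
  have h := pow_mul_norm_iteratedFDeriv_norm hx0 n (x := ‖x‖⁻¹ • x)
    (by rintro h0; rw [h0, norm_zero] at hu; exact zero_ne_one hu)
  rw [smul_inv_smul₀ hx0.ne'] at h
  have hb := hC (‖x‖⁻¹ • x) (by simpa using hu)
  obtain ⟨m, rfl⟩ := Nat.exists_eq_add_of_le' hn
  have h5 : ‖x‖ ^ m * ‖iteratedFDeriv ℝ (m + 1) (fun y : V => ‖y‖) x‖ =
      ‖iteratedFDeriv ℝ (m + 1) (fun y : V => ‖y‖) (‖x‖⁻¹ • x)‖ := by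
    apply mul_left_cancel₀ hx0.ne'
    rw [← h]; ring
  calc _ ≤ ‖x‖ ^ m * ‖iteratedFDeriv ℝ (m + 1) (fun y : V => ‖y‖) x‖ :=
        le_mul_of_one_le_left (norm_nonneg _) (one_le_pow₀ hx)
    _ ≤ C := h5 ▸ hb

theorem norm_iteratedDeriv_cos_le (n : ℕ) (t : ℝ) : ‖iteratedDeriv n Real.cos t‖ ≤ 1 := by
  -- Differentiation exchanges `cos` and `sin` up to sign, so the induction carries both.
  have : ∀ n t, |iteratedDeriv n Real.cos t| ≤ 1 ∧ |iteratedDeriv n Real.sin t| ≤ 1 := by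
    intro n
    induction n with
    | zero => exact fun t => by simp [Real.abs_cos_le_one, Real.abs_sin_le_one]
    | succ n ih =>
      intro t
      rw [iteratedDeriv_succ', iteratedDeriv_succ', Real.deriv_cos', Real.deriv_sin]
      refine ⟨?_, (ih t).1⟩
      rw [iteratedDeriv_fun_neg, abs_neg]
      exact (ih t).2
  exact (this n t).1

theorem exists_norm_iteratedFDeriv_cos_norm_le (n : ℕ) :
    ∃ C : ℝ, ∀ x : V, ‖iteratedFDeriv ℝ n (fun y : V => Real.cos ‖y‖) x‖ ≤ C := by
  choose! A hA using exists_norm_iteratedFDeriv_norm_le (V := V)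
  -- The chain-rule estimate asks for a bound `D ^ i` on the `i`-th derivative of the norm. With `D
  -- ≥ 1`, a common bound `D` suffices, and the result is `n! * 1 * D ^ n`.
  obtain ⟨D, hD1, hD⟩ : ∃ D : ℝ, 1 ≤ D ∧ ∀ i ∈ Finset.range (n + 1), A i ≤ D := by
    refine ⟨∑ i ∈ Finset.range (n + 1), |A i| + 1, ?_, fun i hi => ?_⟩
    · have := Finset.sum_nonneg (fun i (_ : i ∈ Finset.range (n + 1)) => abs_nonneg (A i))
      linarith
    · have := Finset.single_le_sum (fun i _ => abs_nonneg (A i)) hi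
      linarith [le_abs_self (A i)]
  have hin : ContinuousOn (iteratedFDeriv ℝ n (fun y : V => Real.cos ‖y‖))
      (Metric.closedBall 0 1) :=
    (contDiff_cos_norm.continuous_iteratedFDeriv (mod_cast le_top)).continuousOn
  obtain ⟨C, hC⟩ := (isCompact_closedBall (0 : V) 1).exists_bound_of_continuousOn hin
  refine ⟨max C (n.factorial * 1 * D ^ n), fun x => ?_⟩
  rcases le_or_gt ‖x‖ 1 with hx | hx
  · exact (hC x (by simpa using hx)).trans (le_max_left _ _)
  refine le_trans ?_ (le_max_right _ _)
  have hopen : IsOpen ({0}ᶜ : Set V) := isOpen_compl_singleton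
  have hx0 : x ∈ ({0}ᶜ : Set V) := by
    rintro rfl
    simp at hx
    linarith
  have key := norm_iteratedFDerivWithin_comp_le (𝕜 := ℝ) (g := Real.cos) (f := fun y : V => ‖y‖)
    (n := n) (s := {0}ᶜ) (t := Set.univ) (x := x) (N := ∞) (C := 1) (D := D)
    Real.contDiff_cos.contDiffOn
    (fun y hy => (contDiffAt_norm ℝ (by simpa using hy)).contDiffWithinAt)
    (mod_cast le_top) uniqueDiffOn_univ hopen.uniqueDiffOn (Set.mapsTo_univ _ _) hx0
    (fun i _ => by
      rw [iteratedFDerivWithin_univ, norm_iteratedFDeriv_eq_norm_iteratedDeriv]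
      exact norm_iteratedDeriv_cos_le i _)
    (fun i hi hin => by
      rw [iteratedFDerivWithin_of_isOpen i hopen hx0]
      exact ((hA i hi x hx.le).trans (hD i (by simp; omega))).trans
        (le_self_pow₀ hD1 (by omega)))
  rw [iteratedFDerivWithin_of_isOpen n hopen hx0] at key
  exact key

end Norm

namespace Sjostrand

theorem cosNorm_mem_CbInfty (d : ℕ) : cosNorm d ∈ CbInfty d := by
  have hcomp : (cosNorm d : E d → ℂ) =
      Complex.ofRealCLM ∘ fun x : E d => Real.cos ‖x‖ := rfl
  refine ⟨?_, fun n => ?_⟩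
  · rw [hcomp]
    exact Complex.ofRealCLM.contDiff.comp contDiff_cos_norm
  · obtain ⟨C, hC⟩ := exists_norm_iteratedFDeriv_cos_norm_le (V := E d) n
    refine ⟨‖Complex.ofRealCLM‖ * C, fun x => ?_⟩
    rw [hcomp, Complex.ofRealCLM.iteratedFDeriv_comp_left (i := n) (n := n)
      (contDiff_cos_norm.of_le (mod_cast le_top)).contDiffAt le_rfl]
    exact (ContinuousLinearMap.norm_compContinuousMultilinearMap_le _ _).trans
      (mul_le_mul_of_nonneg_left (hC x) (norm_nonneg _))

end Sjostrand

/-! ### Integrals with respect to complex measures -/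

section ComplexMeasureIntegral

open MeasureTheory Filter Topology

variable {X : Type*} [MeasurableSpace X]

/-- Integration of bounded functions against a complex measure is a linear combination of
integrations against finite positive measures. -/
theorem MeasureTheory.ComplexMeasure.exists_integral_eq_sum (μ : ComplexMeasure X) :
    ∃ (c : Fin 4 → ℂ) (ν : Fin 4 → Measure X), (∀ j, IsFiniteMeasure (ν j)) ∧ (∀ j, ‖c j‖ ≤ 1) ∧
      ∀ (f : X → ℂ) (C : ℝ), StronglyMeasurable f → (∀ x, ‖f x‖ ≤ C) →
        VectorMeasure.integral μ f (ContinuousLinearMap.mul ℝ ℂ) = ∑ j, c j * ∫ x, f x ∂ν j := by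
  have := Sjostrand.isFiniteMeasure_variation μ
  let J₁ := (ComplexMeasure.re μ).toJordanDecomposition
  let J₂ := (ComplexMeasure.im μ).toJordanDecomposition
  let c : Fin 4 → ℂ := ![1, -1, Complex.I, -Complex.I]
  let ν : Fin 4 → Measure X := ![J₁.posPart, J₁.negPart, J₂.posPart, J₂.negPart]
  have hν : ∀ j, IsFiniteMeasure (ν j) := by
    intro j
    fin_cases j <;> simp [ν] <;> infer_instance
  have hμ : ∀ s, MeasurableSet s → μ s = ∑ j, c j * ((ν j).real s : ℂ) := by
    intro s hs
    have h₁ : (μ s).re = J₁.posPart.real s - J₁.negPart.real s := by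
      have h := congrArg (fun v : SignedMeasure X => v s)
        (SignedMeasure.toSignedMeasure_toJordanDecomposition (ComplexMeasure.re μ))
      rw [← Measure.toSignedMeasure_apply_measurable hs, ← Measure.toSignedMeasure_apply_measurable hs]
      exact h.symm
    have h₂ : (μ s).im = J₂.posPart.real s - J₂.negPart.real s := by
      have h := congrArg (fun v : SignedMeasure X => v s)
        (SignedMeasure.toSignedMeasure_toJordanDecomposition (ComplexMeasure.im μ))
      rw [← Measure.toSignedMeasure_apply_measurable hs, ← Measure.toSignedMeasure_apply_measurable hs]
      exact h.symm
    rw [← Complex.re_add_im (μ s), h₁, h₂]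
    simp [Fin.sum_univ_four, c, ν]
    ring
  refine ⟨c, ν, hν, fun j => by fin_cases j <;> simp [c], ?_⟩
  have hsimple : ∀ f : SimpleFunc X ℂ,
      VectorMeasure.integral μ f (ContinuousLinearMap.mul ℝ ℂ) = ∑ j, c j * ∫ x, f x ∂ν j := by
    intro f
    induction f using SimpleFunc.induction with
    | const a hs =>
      simp only [SimpleFunc.coe_piecewise, SimpleFunc.coe_const, Set.piecewise_eq_indicator,
        SimpleFunc.const_zero, SimpleFunc.coe_zero]
      have h := VectorMeasure.integral_indicator_const (μ := μ)
        (B := ContinuousLinearMap.mul ℝ ℂ) a hs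
      refine Eq.trans h ?_
      rw [ContinuousLinearMap.mul_apply', hμ _ hs, Finset.mul_sum]
      refine Finset.sum_congr rfl fun j _ => ?_
      have h2 := integral_indicator_const (μ := ν j) a hs
      have h3 : ∫ x, (_ : Set X).indicator (Function.const X a) x ∂ν j = _ := h2
      rw [h3]
      simp only [Complex.real_smul]
      ring
    | add hd hf hg =>
      rename_i f g
      have hint : ∀ (h : SimpleFunc X ℂ) (m : Measure X) [IsFiniteMeasure m], Integrable h m :=
        fun h m _ => h.integrable_of_isFiniteMeasure
      have h1 := VectorMeasure.integral_add (μ := μ) (B := ContinuousLinearMap.mul ℝ ℂ)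
        (f := f) (g := g) (hint f _) (hint g _)
      rw [SimpleFunc.coe_add]
      refine h1.trans ?_
      rw [hf, hg, ← Finset.sum_add_distrib]
      refine Finset.sum_congr rfl fun j _ => ?_
      have := hν j
      simp only [Pi.add_apply]
      rw [integral_add (hint f _) (hint g _), mul_add]
  intro f C hf hC
  -- The truncated approximations keep the bound `C`, so dominated convergence applies on both sides
  -- of the identity.
  let F : ℕ → SimpleFunc X ℂ := hf.approxBounded C
  have hF : ∀ n x, ‖F n x‖ ≤ C := fun n x =>
    hf.norm_approxBounded_le ((norm_nonneg _).trans (hC x)) n x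
  have hlim : ∀ x, Tendsto (fun n => F n x) atTop (𝓝 (f x)) := fun x =>
    hf.tendsto_approxBounded_of_norm_le (hC x)
  have hl : Tendsto (fun n => VectorMeasure.integral μ (F n) (ContinuousLinearMap.mul ℝ ℂ)) atTop
      (𝓝 (VectorMeasure.integral μ f (ContinuousLinearMap.mul ℝ ℂ))) :=
    VectorMeasure.tendsto_integral_of_dominated_convergence (fun _ => C)
    (fun n => (F n).aestronglyMeasurable) (integrable_const _)
    (fun n => Eventually.of_forall (hF n)) (Eventually.of_forall hlim)
  have hr : Tendsto (fun n => ∑ j, c j * ∫ x, F n x ∂ν j) atTop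
      (𝓝 (∑ j, c j * ∫ x, f x ∂ν j)) := by
    refine tendsto_finsetSum _ fun j _ => Tendsto.const_mul _ ?_
    have := hν j
    exact tendsto_integral_of_dominated_convergence (fun _ => C)
      (fun n => (F n).aestronglyMeasurable) (integrable_const _)
      (fun n => Eventually.of_forall (hF n)) (Eventually.of_forall hlim)
  refine tendsto_nhds_unique hl (hr.congr fun n => (hsimple (F n)).symm)

end ComplexMeasureIntegral

namespace Sjostrand

open MeasureTheory Filter Topology

variable {d : ℕ}

/-! ### The short-time Fourier transform of a bounded continuous function -/

/-- Up to a constant and a phase, `V_g f (x, ξ)` is the Fourier transform of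
`f(· + x) conj(g)` at `ξ / (2πħ)`. -/
theorem norm_stft_toDistribution {ħ : ℝ} (hħ : 0 < ħ) (g : 𝓢(E d, ℂ)) (f : E d →ᵇ ℂ) (x ξ : E d) :
    ‖stft ħ g (toDistribution f) x ξ‖ = (2 * Real.pi * ħ) ^ (-(d : ℝ) / 2) *
      ‖FourierTransform.fourier (fun y : E d => f (y + x) * conjSchwartz g y)
        ((2 * Real.pi * ħ)⁻¹ • ξ)‖ := by
  set c : ℝ := (2 * Real.pi * ħ) ^ (-(d : ℝ) / 2) with hc
  have hc0 : 0 ≤ c := by positivity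
  set u : ℂ := Complex.exp (((-(inner ℝ ξ x / ħ) : ℝ) : ℂ) * Complex.I)
  have key : stft ħ g (toDistribution f) x ξ = c * u *
      FourierTransform.fourier (fun y : E d => f (y + x) * conjSchwartz g y)
        ((2 * Real.pi * ħ)⁻¹ • ξ) := by
    rw [stft, toDistribution_apply, Real.fourier_eq', ← integral_add_right_eq_self _ x,
      ← integral_const_mul]
    congr 1
    ext y
    rw [conjSchwartz_apply, phaseShift_apply, modulation, conjSchwartz_apply, smul_eq_mul,
      add_sub_cancel_right]
    have h1 : (-2 * Real.pi * inner ℝ y ((2 * Real.pi * ħ)⁻¹ • ξ) : ℝ) = -(inner ℝ ξ y / ħ) := by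
      rw [inner_smul_right, real_inner_comm]
      field_simp
    have h2 : (starRingEnd ℂ) (Complex.exp (((inner ℝ ξ (y + x) / ħ : ℝ) : ℂ) * Complex.I)) =
        u * Complex.exp (((-(inner ℝ ξ y / ħ) : ℝ) : ℂ) * Complex.I) := by
      rw [← Complex.exp_conj, ← Complex.exp_add, inner_add_right]
      congr 1
      simp only [map_mul, Complex.conj_ofReal, Complex.conj_I]
      push_cast
      ring
    rw [h1, map_mul, map_mul, h2, Complex.conj_ofReal, ← hc]
    ring
  rw [key, norm_mul, norm_mul, Complex.norm_exp_ofReal_mul_I, Complex.norm_real,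
    Real.norm_of_nonneg hc0, mul_one]

/-- A bounded continuous function belongs to the Sjöstrand class as soon as the Fourier transforms
of its windowed translates have a common integrable bound. -/
theorem toDistribution_mem_sjostrandClass {ħ : ℝ} (hħ : 0 < ħ) {g : 𝓢(E d, ℂ)} (hg : g ≠ 0)
    {f : E d →ᵇ ℂ} {G : E d → ℝ} (hG : Integrable G)
    (hbound : ∀ x ζ : E d,
      ‖FourierTransform.fourier (fun y : E d => f (y + x) * conjSchwartz g y) ζ‖ ≤ G ζ) :
    toDistribution f ∈ sjostrandClass ħ d := by
  refine ⟨g, hg, ?_⟩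
  set c : ℝ := (2 * Real.pi * ħ) ^ (-(d : ℝ) / 2) with hc
  have hc0 : 0 ≤ c := by positivity
  have hint : Integrable fun ξ : E d => c * G ((2 * Real.pi * ħ)⁻¹ • ξ) :=
    (hG.comp_smul (by positivity)).const_mul c
  refine lt_of_le_of_lt (lintegral_mono fun ξ => ?_) hint.2
  refine iSup_le fun x => ?_
  rw [← ofReal_norm, ← ofReal_norm]
  refine ENNReal.ofReal_le_ofReal ?_
  rw [norm_stft_toDistribution hħ]
  exact (mul_le_mul_of_nonneg_left (hbound x _) hc0).trans (Real.le_norm_self _)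

theorem exists_schwartz_ne_zero (d : ℕ) : ∃ g : 𝓢(E d, ℂ), g ≠ 0 := by
  let b : ContDiffBump (0 : E d) := ⟨1, 2, by norm_num, by norm_num⟩
  have h1 : HasCompactSupport (Complex.ofRealCLM ∘ b) := b.hasCompactSupport.comp_left rfl
  have h2 : ContDiff ℝ ∞ (Complex.ofRealCLM ∘ b) := Complex.ofRealCLM.contDiff.comp b.contDiff
  refine ⟨h1.toSchwartzMap h2, fun h => ?_⟩
  have h3 := congrArg (fun φ : 𝓢(E d, ℂ) => φ 0) h
  have h4 : b 0 = 1 := b.one_of_mem_closedBall (Metric.mem_closedBall_self zero_le_one)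
  simp [h4] at h3

/-! ### Smooth functions with bounded derivatives -/

theorem CbInfty.comp_add_right {f : E d →ᵇ ℂ} (hf : f ∈ CbInfty d) (x : E d) :
    ContDiff ℝ ∞ (fun y => f (y + x)) :=
  hf.1.comp (contDiff_id.add contDiff_const)

theorem CbInfty.hasTemperateGrowth_comp_add_right {f : E d →ᵇ ℂ} (hf : f ∈ CbInfty d) (x : E d) :
    (fun y => f (y + x)).HasTemperateGrowth := by
  refine ⟨CbInfty.comp_add_right hf x, fun n => ?_⟩
  obtain ⟨C, hC⟩ := hf.2 n
  exact ⟨0, C, fun y => by rw [iteratedFDeriv_comp_add_right]; simpa using hC _⟩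

/-- The Schwartz function `f(· + x) g` for `f ∈ C_b^∞`. -/
noncomputable def translateMul (f : E d →ᵇ ℂ) (g : 𝓢(E d, ℂ)) (x : E d) : 𝓢(E d, ℂ) :=
  SchwartzMap.smulLeftCLM ℂ (fun y => f (y + x)) g

theorem translateMul_coe {f : E d →ᵇ ℂ} (hf : f ∈ CbInfty d) (g : 𝓢(E d, ℂ)) (x : E d) :
    (translateMul f g x : E d → ℂ) = fun y => f (y + x) * g y := by
  ext y
  simp [translateMul,
    SchwartzMap.smulLeftCLM_apply_apply (CbInfty.hasTemperateGrowth_comp_add_right hf x)]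

/-- Leibniz rule: the bounds on the derivatives of `f` are translation invariant, so `M` does not
depend on `x`. -/
theorem exists_seminorm_translateMul_le {f : E d →ᵇ ℂ} (hf : f ∈ CbInfty d) (g : 𝓢(E d, ℂ))
    (k n : ℕ) : ∃ M : ℝ, 0 ≤ M ∧ ∀ x, SchwartzMap.seminorm ℂ k n (translateMul f g x) ≤ M := by
  choose C hC using hf.2
  have hC0 : ∀ i, 0 ≤ C i := fun i => (norm_nonneg _).trans (hC i 0)
  refine ⟨∑ i ∈ Finset.range (n + 1), n.choose i * C i * SchwartzMap.seminorm ℂ k (n - i) g,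
    Finset.sum_nonneg fun i _ => mul_nonneg (mul_nonneg (Nat.cast_nonneg _) (hC0 i))
      (apply_nonneg _ _), fun x => ?_⟩
  refine SchwartzMap.seminorm_le_bound ℂ k n _ (Finset.sum_nonneg fun i _ =>
    mul_nonneg (mul_nonneg (Nat.cast_nonneg _) (hC0 i)) (apply_nonneg _ _)) fun y => ?_
  rw [translateMul_coe hf]
  refine (mul_le_mul_of_nonneg_left (norm_iteratedFDeriv_mul_le (N := ∞)
    (CbInfty.comp_add_right hf x) (g.smooth _) y (mod_cast le_top)) (by positivity)).trans ?_
  rw [Finset.mul_sum]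
  refine Finset.sum_le_sum fun i _ => ?_
  rw [iteratedFDeriv_comp_add_right]
  calc ‖y‖ ^ k * (n.choose i * ‖iteratedFDeriv ℝ i f (y + x)‖ * ‖iteratedFDeriv ℝ (n - i) g y‖)
      = n.choose i * ‖iteratedFDeriv ℝ i f (y + x)‖ *
        (‖y‖ ^ k * ‖iteratedFDeriv ℝ (n - i) g y‖) := by ring
    _ ≤ n.choose i * C i * SchwartzMap.seminorm ℂ k (n - i) g := by
        gcongr
        · exact mul_nonneg (Nat.cast_nonneg _) (hC0 i)
        · exact hC i _
        · exact SchwartzMap.le_seminorm ℂ k (n - i) g y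

/-- Continuity of the Fourier transform on Schwartz space turns the uniform seminorm bounds into
decay uniform in `x`. -/
theorem exists_norm_fourier_translateMul_le {f : E d →ᵇ ℂ} (hf : f ∈ CbInfty d) (g : 𝓢(E d, ℂ))
    (k : ℕ) : ∃ M : ℝ, ∀ x ζ : E d, (1 + ‖ζ‖) ^ k *
      ‖FourierTransform.fourier (fun y => f (y + x) * g y) ζ‖ ≤ M := by
  let q : Seminorm ℂ 𝓢(E d, ℂ) :=
    ((Finset.Iic (k, 0)).sup fun m : ℕ × ℕ => SchwartzMap.seminorm ℂ m.1 m.2).comp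
      (FourierTransform.fourierCLM ℂ 𝓢(E d, ℂ)).toLinearMap
  have hq : Continuous q := by
    have h : ∀ t : Finset (ℕ × ℕ),
        Continuous (t.sup fun m : ℕ × ℕ => SchwartzMap.seminorm ℂ m.1 m.2 :
          Seminorm ℂ 𝓢(E d, ℂ)) := by
      intro t
      induction t using Finset.induction_on with
      | empty => exact continuous_const
      | insert i t _ ih =>
        rw [Finset.sup_insert]
        exact ((schwartz_withSeminorms ℂ (E d) ℂ).continuous_seminorm i).sup ih
    exact (h _).comp (FourierTransform.fourierCLM ℂ 𝓢(E d, ℂ)).continuous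
  obtain ⟨s, C, -, hC⟩ :=
    Seminorm.bound_of_continuous (schwartz_withSeminorms ℂ (E d) ℂ) q hq
  choose M hM0 hM using exists_seminorm_translateMul_le hf g
  let B : ℝ := ∑ i ∈ s, M i.1 i.2
  have hB : ∀ x, s.sup (schwartzSeminormFamily ℂ (E d) ℂ) (translateMul f g x) ≤ B := fun x =>
    Seminorm.finset_sup_apply_le (Finset.sum_nonneg fun i _ => hM0 _ _) fun i hi =>
      (hM i.1 i.2 x).trans
        (Finset.single_le_sum (f := fun i : ℕ × ℕ => M i.1 i.2) (fun i _ => hM0 _ _) hi)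
  refine ⟨2 ^ k * (C * B), fun x ζ => ?_⟩
  have h1 := SchwartzMap.one_add_le_sup_seminorm_apply (𝕜 := ℂ) (m := (k, 0)) le_rfl le_rfl
    (FourierTransform.fourier (translateMul f g x)) ζ
  rw [norm_iteratedFDeriv_zero, SchwartzMap.fourier_coe, translateMul_coe hf] at h1
  refine h1.trans (mul_le_mul_of_nonneg_left ?_ (by positivity))
  refine (hC (translateMul f g x)).trans ?_
  exact mul_le_mul_of_nonneg_left (hB x) C.2

theorem toDistribution_CbInfty_subset {ħ : ℝ} (hħ : 0 < ħ) :
    toDistribution '' CbInfty d ⊆ sjostrandClass ħ d := by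
  rintro _ ⟨f, hf, rfl⟩
  obtain ⟨g, hg⟩ := exists_schwartz_ne_zero d
  -- Decay of order `d + 1`, above the dimension, is integrable.
  obtain ⟨M, hM⟩ := exists_norm_fourier_translateMul_le hf (conjSchwartz g) (d + 1)
  have hint : Integrable fun ζ : E d => M * (1 + ‖ζ‖) ^ (-((d + 1 : ℕ) : ℝ)) :=
    (integrable_one_add_norm (by simp)).const_mul M
  refine toDistribution_mem_sjostrandClass hħ hg hint fun x ζ => ?_
  rw [Real.rpow_neg (by positivity), Real.rpow_natCast, ← div_eq_mul_inv,
    le_div_iff₀ (by positivity), mul_comm]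
  exact hM x ζ

end Sjostrand

namespace Sjostrand

open MeasureTheory Filter Topology

variable {d : ℕ}

/-! ### Fourier transforms of measures belong to the Sjöstrand class -/

theorem fourierIntegral_eq_sum (μ : ComplexMeasure (E d)) :
    ∃ (c : Fin 4 → ℂ) (ν : Fin 4 → Measure (E d)), (∀ j, IsFiniteMeasure (ν j)) ∧
      (∀ j, ‖c j‖ ≤ 1) ∧ ∀ x, fourierIntegral μ x =
        ∑ j, c j * ∫ η, Complex.exp (((inner ℝ η x : ℝ) : ℂ) * Complex.I) ∂ν j := by
  obtain ⟨c, ν, hν, hc, h⟩ := ComplexMeasure.exists_integral_eq_sum μ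
  refine ⟨c, ν, hν, hc, fun x => h _ 1 ?_ fun η => (Complex.norm_exp_ofReal_mul_I _).le⟩
  exact Continuous.stronglyMeasurable (by fun_prop)

theorem integrable_exp_mul_exp_mul (ν : Measure (E d)) [IsFiniteMeasure ν] (h : 𝓢(E d, ℂ))
    (x ζ : E d) : Integrable (fun p : E d × E d =>
      Complex.exp (((-2 * Real.pi * inner ℝ p.1 ζ : ℝ) : ℂ) * Complex.I) *
        (Complex.exp (((inner ℝ p.2 (p.1 + x) : ℝ) : ℂ) * Complex.I) * h p.1))
      (volume.prod ν) := by
  have hc : Continuous h := h.continuous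
  refine (h.integrable.norm.mul_prod (integrable_const (μ := ν) (1 : ℝ))).mono'
    (Continuous.aestronglyMeasurable (by fun_prop)) (Eventually.of_forall fun p => ?_)
  rw [norm_mul, norm_mul, Complex.norm_exp_ofReal_mul_I, Complex.norm_exp_ofReal_mul_I]
  simp

/-- Fubini, with the phases regrouped: `-2π y·ζ + η·y = -2π y·(ζ - η/(2π))`. The shift `x` survives
only in a unimodular factor. -/
theorem integral_exp_mul_integral_exp_mul (ν : Measure (E d)) [IsFiniteMeasure ν] (h : 𝓢(E d, ℂ))
    (x ζ : E d) :
    ∫ y, Complex.exp (((-2 * Real.pi * inner ℝ y ζ : ℝ) : ℂ) * Complex.I) *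
        ((∫ η, Complex.exp (((inner ℝ η (y + x) : ℝ) : ℂ) * Complex.I) ∂ν) * h y) =
      ∫ η, Complex.exp (((inner ℝ η x : ℝ) : ℂ) * Complex.I) *
        FourierTransform.fourier h (ζ - (2 * Real.pi)⁻¹ • η) ∂ν := by
  have hswap := integral_integral_swap (μ := volume) (ν := ν) (f := fun y η =>
      Complex.exp (((-2 * Real.pi * inner ℝ y ζ : ℝ) : ℂ) * Complex.I) *
        (Complex.exp (((inner ℝ η (y + x) : ℝ) : ℂ) * Complex.I) * h y))
    (integrable_exp_mul_exp_mul ν h x ζ)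
  simp_rw [integral_const_mul, integral_mul_const] at hswap
  rw [hswap]
  congr 1
  ext η
  rw [SchwartzMap.fourier_coe, Real.fourier_eq', ← integral_const_mul]
  congr 1
  ext y
  rw [smul_eq_mul, ← mul_assoc, ← mul_assoc, ← Complex.exp_add, ← Complex.exp_add]
  congr 2
  rw [inner_sub_right, inner_smul_right, inner_add_right, real_inner_comm η y]
  have : (Real.pi : ℂ) ≠ 0 := by exact_mod_cast Real.pi_ne_zero
  push_cast
  field_simp
  ring

theorem norm_fourier_fourierIntegral_mul_le {μ : ComplexMeasure (E d)} {c : Fin 4 → ℂ}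
    {ν : Fin 4 → Measure (E d)} [∀ j, IsFiniteMeasure (ν j)] (hc : ∀ j, ‖c j‖ ≤ 1)
    (hμ : ∀ x, fourierIntegral μ x =
        ∑ j, c j * ∫ η, Complex.exp (((inner ℝ η x : ℝ) : ℂ) * Complex.I) ∂ν j)
    (h : 𝓢(E d, ℂ)) (x ζ : E d) :
    ‖FourierTransform.fourier (fun y => fourierIntegral μ (y + x) * h y) ζ‖ ≤
      ∑ j, ∫ η, ‖FourierTransform.fourier h (ζ - (2 * Real.pi)⁻¹ • η)‖ ∂ν j := by
  have key : FourierTransform.fourier (fun y => fourierIntegral μ (y + x) * h y) ζ =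
      ∑ j, c j * ∫ η, Complex.exp (((inner ℝ η x : ℝ) : ℂ) * Complex.I) *
        FourierTransform.fourier h (ζ - (2 * Real.pi)⁻¹ • η) ∂ν j := by
    rw [Real.fourier_eq']
    simp_rw [hμ, smul_eq_mul, Finset.sum_mul, Finset.mul_sum]
    rw [integral_finsetSum]
    · refine Finset.sum_congr rfl fun j _ => ?_
      rw [← integral_exp_mul_integral_exp_mul, ← integral_const_mul]
      congr 1
      ext y
      ring
    · intro j _
      have hj := ((integrable_exp_mul_exp_mul (ν j) h x ζ).integral_prod_left).const_mul (c j)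
      refine hj.congr (Eventually.of_forall fun y => ?_)
      simp_rw [integral_const_mul, integral_mul_const]
      ring
  rw [key]
  refine (norm_sum_le _ _).trans (Finset.sum_le_sum fun j _ => ?_)
  rw [norm_mul]
  refine (mul_le_of_le_one_left (norm_nonneg _) (hc j)).trans
    ((norm_integral_le_integral_norm _).trans_eq ?_)
  simp_rw [norm_mul, Complex.norm_exp_ofReal_mul_I, one_mul]

/-- By translation invariance the inner integral in `ζ` is the same for every `η`, and `ν` is
finite. -/
theorem integrable_integral_norm_sub_smul (ν : Measure (E d)) [IsFiniteMeasure ν]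
    (φ : 𝓢(E d, ℂ)) (t : ℝ) : Integrable fun ζ : E d => ∫ η, ‖φ (ζ - t • η)‖ ∂ν := by
  have hc : Continuous φ := φ.continuous
  have hprod : Integrable (fun p : E d × E d => ‖φ (p.1 - t • p.2)‖) (volume.prod ν) := by
    rw [integrable_prod_iff' (Continuous.aestronglyMeasurable (by fun_prop))]
    refine ⟨Eventually.of_forall fun η => φ.integrable.norm.comp_sub_right (t • η), ?_⟩
    simp_rw [norm_norm]
    have : ∀ η : E d, ∫ ζ, ‖φ (ζ - t • η)‖ = ∫ ζ, ‖φ ζ‖ := fun η =>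
      integral_sub_right_eq_self (fun ζ => ‖φ ζ‖) (t • η)
    simp_rw [this]
    exact integrable_const _
  exact hprod.integral_prod_left

theorem toDistribution_FM_subset {ħ : ℝ} (hħ : 0 < ħ) :
    toDistribution '' FM d ⊆ sjostrandClass ħ d := by
  rintro _ ⟨_, ⟨μ, rfl⟩, rfl⟩
  obtain ⟨g, hg⟩ := exists_schwartz_ne_zero d
  obtain ⟨c, ν, hν, hc, hμ⟩ := fourierIntegral_eq_sum μ
  exact toDistribution_mem_sjostrandClass hħ hg
    (integrable_finsetSum _ fun j _ => integrable_integral_norm_sub_smul (ν j)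
      (FourierTransform.fourier (conjSchwartz g)) (2 * Real.pi)⁻¹)
    fun x ζ => norm_fourier_fourierIntegral_mul_le hc hμ (conjSchwartz g) x ζ

/-- This carries non-membership in `FM` over to distributions: the distribution determines the
function almost everywhere, hence everywhere by continuity. -/
theorem toDistribution_injective : Function.Injective (toDistribution (d := d)) := by
  intro f₁ f₂ h
  have h1 : (memLp_top f₁).toLp f₁ = (memLp_top f₂).toLp f₂ := by
    have hker := Lp.ker_toTemperedDistributionCLM_eq_bot (F := ℂ) (p := ⊤)
      (μ := (volume : Measure (E d)))
    rw [LinearMap.ker_eq_bot] at hker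
    exact hker h
  have h2 : (f₁ : E d → ℂ) =ᵐ[volume] f₂ := (MemLp.toLp_eq_toLp_iff _ _).1 h1
  exact DFunLike.coe_injective ((f₁.continuous.ae_eq_iff_eq volume f₂.continuous).1 h2)

end Sjostrand

namespace Sjostrand

open MeasureTheory Filter Topology

variable {d : ℕ}

/-! ### `cos ‖x‖` is not the Fourier transform of a measure -/

/-- Along the translates `x + 2πm e`, the function `cos ‖·‖` converges to a plane wave. -/
theorem tendsto_cos_norm_add {V : Type*} [NormedAddCommGroup V] [InnerProductSpace ℝ V]
    {e : V} (he : ‖e‖ = 1) (x : V) :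
    Tendsto (fun m : ℕ => Real.cos ‖x + (m * (2 * Real.pi)) • e‖) atTop
      (𝓝 (Real.cos (inner ℝ x e))) := by
  set a := inner ℝ x e with ha
  -- `b` is the squared length of the part of `x` orthogonal to `e`. By Pythagoras `‖x + R • e‖`
  -- exceeds `R + a` by at most `b / (R + a)`.
  set b := ‖x‖ ^ 2 - a ^ 2 with hb
  have hab : 0 ≤ b := by
    have h := abs_real_inner_le_norm x e
    rw [he, mul_one] at h
    have := sq_le_sq' (by linarith [neg_abs_le (inner ℝ x e), norm_nonneg x]) (le_of_abs_le h)
    linarith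
  have hR : Tendsto (fun m : ℕ => (m : ℝ) * (2 * Real.pi) + a) atTop atTop :=
    tendsto_atTop_add_const_right _ _
      (tendsto_natCast_atTop_atTop.atTop_mul_const (by positivity))
  rw [tendsto_iff_dist_tendsto_zero]
  refine squeeze_zero' (Eventually.of_forall fun _ => dist_nonneg) ?_ (hR.const_div_atTop b)
  filter_upwards [hR.eventually_gt_atTop 0] with m hm
  set R := (m : ℝ) * (2 * Real.pi) with hRdef
  have hN : ‖x + R • e‖ ^ 2 = (R + a) ^ 2 + b := by
    rw [norm_add_sq_real, inner_smul_right, norm_smul, he, mul_one, Real.norm_eq_abs, sq_abs]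
    ring
  have h1 : R + a ≤ ‖x + R • e‖ := by
    apply le_of_sq_le_sq _ (norm_nonneg _)
    linarith
  have h2 : ‖x + R • e‖ - (R + a) ≤ b / (R + a) := by
    rw [le_div_iff₀ hm]
    nlinarith
  have h3 : Real.cos a = Real.cos (R + a) := by
    rw [add_comm, hRdef, Real.cos_add_nat_mul_two_pi]
  rw [h3]
  refine le_trans ?_ h2
  have h4 := Real.lipschitzWith_cos.dist_le_mul ‖x + R • e‖ (R + a)
  rw [Real.dist_eq (‖x + R • e‖), abs_of_nonneg (by linarith)] at h4
  simpa using h4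

/-- Linear combinations of values of the Fourier transform of a complex measure are controlled by
the `L¹` norm of the associated trigonometric polynomial. -/
theorem exists_norm_sum_fourierIntegral_le (μ : ComplexMeasure (E d)) :
    ∃ ν : Measure (E d), IsFiniteMeasure ν ∧ ∀ (s : Finset ℕ) (a : ℕ → ℂ) (x : ℕ → E d),
      ‖∑ k ∈ s, a k * fourierIntegral μ (x k)‖ ≤
        ∫ ξ, ‖∑ k ∈ s, a k * Complex.exp (((inner ℝ ξ (x k) : ℝ) : ℂ) * Complex.I)‖ ∂ν := by
  obtain ⟨c, ν, hν, hc, hμ⟩ := fourierIntegral_eq_sum μ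
  refine ⟨∑ j, ν j, inferInstance, fun s a x => ?_⟩
  have hint : ∀ j y, Integrable (fun ξ : E d =>
      Complex.exp (((inner ℝ ξ y : ℝ) : ℂ) * Complex.I)) (ν j) := fun j y =>
    Integrable.of_bound (Continuous.aestronglyMeasurable (by fun_prop)) 1
      (Eventually.of_forall fun ξ => (Complex.norm_exp_ofReal_mul_I _).le)
  have hsum : ∀ j, Integrable (fun ξ : E d =>
      ∑ k ∈ s, a k * Complex.exp (((inner ℝ ξ (x k) : ℝ) : ℂ) * Complex.I)) (ν j) := fun j =>
    integrable_finsetSum _ fun k _ => (hint j _).const_mul _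
  have key : ∑ k ∈ s, a k * fourierIntegral μ (x k) =
      ∑ j, c j * ∫ ξ, ∑ k ∈ s, a k * Complex.exp (((inner ℝ ξ (x k) : ℝ) : ℂ) * Complex.I)
        ∂ν j := by
    simp_rw [hμ, Finset.mul_sum]
    rw [Finset.sum_comm]
    refine Finset.sum_congr rfl fun j _ => ?_
    rw [integral_finsetSum _ fun k _ => (hint j _).const_mul _, Finset.mul_sum]
    refine Finset.sum_congr rfl fun k _ => ?_
    rw [integral_const_mul]
    ring
  rw [key, integral_finsetSum_measure fun j _ => (hsum j).norm]
  refine (norm_sum_le _ _).trans (Finset.sum_le_sum fun j _ => ?_)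
  rw [norm_mul]
  exact (mul_le_of_le_one_left (norm_nonneg _) (hc j)).trans (norm_integral_le_integral_norm _)

/-- Strict convexity of the disc: the midpoint of two distinct unit vectors is interior. Hence
powers of `(1 + z) / 2` tend to `0` unless `z = 1`. -/
theorem norm_one_add_div_two_lt_one {z : ℂ} (hz : ‖z‖ = 1) (hz1 : z ≠ 1) :
    ‖(1 + z) / 2‖ < 1 := by
  have h : ‖(1 : ℂ) + z‖ < ‖(1 : ℂ)‖ + ‖z‖ :=
    norm_add_lt_of_not_sameRay fun hr => hz1 (by
      have := hr.norm_smul_eq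
      simpa [hz] using this)
  rw [norm_div, Complex.norm_ofNat]
  rw [norm_one, hz] at h
  linarith

/-- Binomial expansion of the powers of `(1 + e^{i(θ - c)}) / 2`. -/
theorem sum_binomial_mul_exp (n : ℕ) (c θ : ℝ) :
    ∑ k ∈ Finset.range (n + 1), ((n.choose k : ℂ) / 2 ^ n *
      Complex.exp (((-(k * c) : ℝ) : ℂ) * Complex.I)) *
      Complex.exp (((k * θ : ℝ) : ℂ) * Complex.I) =
    ((1 + Complex.exp (((θ - c : ℝ) : ℂ) * Complex.I)) / 2) ^ n := by
  rw [div_pow, add_comm (1 : ℂ), add_pow, Finset.sum_div]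
  refine Finset.sum_congr rfl fun k _ => ?_
  rw [← Complex.exp_nat_mul, mul_assoc, ← Complex.exp_add, one_pow, mul_one]
  have : ((-(k * c) : ℝ) : ℂ) * Complex.I + ((k * θ : ℝ) : ℂ) * Complex.I =
      k * (((θ - c : ℝ) : ℂ) * Complex.I) := by
    push_cast; ring
  rw [this]
  ring

/-- If `cos ‖·‖` is the Fourier transform of a complex measure, then that measure charges the
union of hyperplanes `⟪ξ, v⟫ ∈ c + 2πℤ` whenever `c = ⟪v, e⟫` with `e` a unit vector. -/
theorem measure_pos_of_fourierIntegral_eq_cos {μ : ComplexMeasure (E d)}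
    (hμ : ∀ x, fourierIntegral μ x = Real.cos ‖x‖) {ν : Measure (E d)} [IsFiniteMeasure ν]
    (hν : ∀ (s : Finset ℕ) (a : ℕ → ℂ) (x : ℕ → E d),
      ‖∑ k ∈ s, a k * fourierIntegral μ (x k)‖ ≤
        ∫ ξ, ‖∑ k ∈ s, a k * Complex.exp (((inner ℝ ξ (x k) : ℝ) : ℂ) * Complex.I)‖ ∂ν)
    {v e : E d} (he : ‖e‖ = 1) {c : ℝ} (hc : inner ℝ v e = c) (hc0 : 0 < c) (hc1 : c < 1) :
    0 < ν {ξ | Complex.exp (((inner ℝ ξ v - c : ℝ) : ℂ) * Complex.I) = 1} := by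
  set A : Set (E d) := {ξ | Complex.exp (((inner ℝ ξ v - c : ℝ) : ℂ) * Complex.I) = 1} with hA
  have hAm : MeasurableSet A :=
    (isClosed_eq (by fun_prop) continuous_const).measurableSet
  let P : ℕ → E d → ℂ := fun n ξ =>
    ((1 + Complex.exp (((inner ℝ ξ v - c : ℝ) : ℂ) * Complex.I)) / 2) ^ n
  -- Writing `cos (k c)` as the mean of `e^{ikc}` and `e^{-ikc}` evaluates the polynomial at the
  -- phases `c` and `-c`, giving `1` and `z ^ n`. As `0 < 2c < 2π`, `‖z‖ < 1`.
  let z : ℂ := (1 + Complex.exp (((-c - c : ℝ) : ℂ) * Complex.I)) / 2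
  have hz : ‖z‖ < 1 := by
    refine norm_one_add_div_two_lt_one (Complex.norm_exp_ofReal_mul_I _) fun h => ?_
    have h2 := congrArg Complex.re h
    rw [Complex.exp_ofReal_mul_I_re, Complex.one_re, show -c - c = -(2 * c) by ring,
      Real.cos_neg, Real.cos_eq_one_iff_of_lt_of_lt] at h2
    · linarith
    · linarith [Real.pi_gt_three]
    · linarith [Real.pi_gt_three]
  have hbound : ∀ n, ‖(1 + z ^ n) / 2‖ ≤ ∫ ξ, ‖P n ξ‖ ∂ν := by
    intro n
    let a : ℕ → ℂ := fun k => (n.choose k : ℂ) / 2 ^ n *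
      Complex.exp (((-(k * c) : ℝ) : ℂ) * Complex.I)
    have hle : ∀ m : ℕ, ‖∑ k ∈ Finset.range (n + 1),
        a k * (Real.cos ‖(k : ℝ) • v + (m * (2 * Real.pi)) • e‖ : ℝ)‖ ≤ ∫ ξ, ‖P n ξ‖ ∂ν := by
      intro m
      have h := hν (Finset.range (n + 1)) a fun k => (k : ℝ) • v + (m * (2 * Real.pi)) • e
      simp_rw [hμ] at h
      refine h.trans_eq ?_
      congr 1
      ext ξ
      -- Shifting all the points by `2πm e` multiplies the polynomial by one common phase, so the
      -- bound is independent of `m`.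
      have hfac : ∑ k ∈ Finset.range (n + 1), a k * Complex.exp
          (((inner ℝ ξ ((k : ℝ) • v + (m * (2 * Real.pi)) • e) : ℝ) : ℂ) * Complex.I) =
          P n ξ * Complex.exp
            (((m * (2 * Real.pi) * inner ℝ ξ e : ℝ) : ℂ) * Complex.I) := by
        simp only [P]
        rw [← sum_binomial_mul_exp n c (inner ℝ ξ v), Finset.sum_mul]
        refine Finset.sum_congr rfl fun k _ => ?_
        rw [inner_add_right, inner_smul_right, inner_smul_right, Complex.ofReal_add, add_mul,
          Complex.exp_add, ← mul_assoc]
      rw [hfac, norm_mul, Complex.norm_exp_ofReal_mul_I, mul_one]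
    have hlim : Tendsto (fun m : ℕ => ‖∑ k ∈ Finset.range (n + 1),
        a k * (Real.cos ‖(k : ℝ) • v + (m * (2 * Real.pi)) • e‖ : ℝ)‖) atTop
        (𝓝 ‖∑ k ∈ Finset.range (n + 1), a k * (Real.cos (k * c) : ℝ)‖) := by
      refine (tendsto_finsetSum _ fun k _ => Tendsto.const_mul _ ?_).norm
      have h := tendsto_cos_norm_add he ((k : ℝ) • v)
      rw [real_inner_smul_left, hc] at h
      exact (Complex.continuous_ofReal.tendsto _).comp h
    have heq : ∑ k ∈ Finset.range (n + 1), a k * (Real.cos (k * c) : ℝ) = (1 + z ^ n) / 2 := by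
      have h1 := sum_binomial_mul_exp n c c
      have h2 := sum_binomial_mul_exp n c (-c)
      rw [sub_self, Complex.ofReal_zero, zero_mul, Complex.exp_zero, one_add_one_eq_two,
        div_self two_ne_zero, one_pow] at h1
      rw [← h1, ← h2, ← Finset.sum_add_distrib, Finset.sum_div]
      refine Finset.sum_congr rfl fun k _ => ?_
      rw [Complex.ofReal_cos, Complex.cos]
      simp only [a]
      push_cast
      ring_nf
    rw [← heq]
    exact le_of_tendsto' hlim hle
  have hleft : Tendsto (fun n => ‖(1 + z ^ n) / 2‖) atTop (𝓝 ‖((1 : ℂ) + 0) / 2‖) :=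
    (((tendsto_pow_atTop_nhds_zero_of_norm_lt_one hz).const_add 1).div_const 2).norm
  have hright : Tendsto (fun n => ∫ ξ, ‖P n ξ‖ ∂ν) atTop
      (𝓝 (∫ ξ, A.indicator (fun _ => (1 : ℝ)) ξ ∂ν)) := by
    have hle : ∀ ξ : E d, ‖(1 + Complex.exp (((inner ℝ ξ v - c : ℝ) : ℂ) * Complex.I)) / 2‖ ≤ 1 := by
      intro ξ
      by_cases h : Complex.exp (((inner ℝ ξ v - c : ℝ) : ℂ) * Complex.I) = 1
      · rw [h]; norm_num
      · exact (norm_one_add_div_two_lt_one (Complex.norm_exp_ofReal_mul_I _) h).le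
    refine tendsto_integral_of_dominated_convergence (fun _ => 1)
      (fun n => Continuous.aestronglyMeasurable (by fun_prop)) (integrable_const _)
      (fun n => Eventually.of_forall fun ξ => ?_) (Eventually.of_forall fun ξ => ?_)
    · rw [norm_norm, norm_pow]
      exact pow_le_one₀ (norm_nonneg _) (hle ξ)
    · simp only [P, norm_pow]
      by_cases h : Complex.exp (((inner ℝ ξ v - c : ℝ) : ℂ) * Complex.I) = 1
      · rw [Set.indicator_of_mem (show ξ ∈ A from h), h]
        norm_num
      · rw [Set.indicator_of_notMem (show ξ ∉ A from h)]
        exact tendsto_pow_atTop_nhds_zero_of_lt_one (norm_nonneg _)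
          (norm_one_add_div_two_lt_one (Complex.norm_exp_ofReal_mul_I _) h)
  -- In the limit this reads `1/2 ≤ ν A`.
  have hfin := le_of_tendsto_of_tendsto' hleft hright hbound
  rw [integral_indicator_const _ hAm, smul_eq_mul, mul_one] at hfin
  by_contra hneg
  rw [measureReal_def, nonpos_iff_eq_zero.1 (not_lt.1 hneg)] at hfin
  norm_num at hfin

theorem cosNorm_notMem_FM (hd : 1 < d) : cosNorm d ∉ FM d := by
  rintro ⟨μ, hμ⟩
  have hcos : ∀ x, fourierIntegral μ x = Real.cos ‖x‖ := fun x =>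
    congrArg (fun f : E d →ᵇ ℂ => f x) hμ
  obtain ⟨ν, hνfin, hν⟩ := exists_norm_sum_fourierIntegral_le μ
  let v : E d := EuclideanSpace.single ⟨0, by omega⟩ 1
  let w : E d := EuclideanSpace.single ⟨1, hd⟩ 1
  have hv : ‖v‖ = 1 := by simp [v]
  have hw : ‖w‖ = 1 := by simp [w]
  have hvw : inner ℝ v w = 0 := by simp [v, w, EuclideanSpace.inner_single_left]
  let A : Set.Ioo (0 : ℝ) 1 → Set (E d) := fun c =>
    {ξ | Complex.exp (((inner ℝ ξ v - c : ℝ) : ℂ) * Complex.I) = 1}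
  have hAm : ∀ c, MeasurableSet (A c) := fun c =>
    (isClosed_eq (by fun_prop) continuous_const).measurableSet
  have hdisj : Pairwise (Function.onFun Disjoint A) := by
    intro c c' hcc'
    refine Set.disjoint_left.2 fun ξ h h' => hcc' (Subtype.ext ?_)
    -- A common point forces `c' - c ∈ 2πℤ`, while `|c' - c| < 1`.
    have hdiv : Complex.exp ((((c' : ℝ) - c : ℝ) : ℂ) * Complex.I) = 1 := by
      have h1 : (((c' : ℝ) - c : ℝ) : ℂ) * Complex.I =
          ((inner ℝ ξ v - c : ℝ) : ℂ) * Complex.I - ((inner ℝ ξ v - c' : ℝ) : ℂ) * Complex.I := by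
        push_cast; ring
      rw [h1, Complex.exp_sub, show Complex.exp _ = 1 from h, show Complex.exp _ = 1 from h',
        div_one]
    have hre := congrArg Complex.re hdiv
    rw [Complex.exp_ofReal_mul_I_re, Complex.one_re, Real.cos_eq_one_iff_of_lt_of_lt] at hre
    · linarith
    · linarith [Real.pi_gt_three, c.2.1, c.2.2, c'.2.1, c'.2.2]
    · linarith [Real.pi_gt_three, c.2.1, c.2.2, c'.2.1, c'.2.2]
  have hpos : ∀ c, 0 < ν (A c) := by
    rintro ⟨c, hc0, hc1⟩
    have hs : 0 ≤ 1 - c ^ 2 := by nlinarith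
    -- The second direction `w`, available since `d > 1`, completes `c • v` to a unit vector.
    let e : E d := c • v + Real.sqrt (1 - c ^ 2) • w
    have he : ‖e‖ = 1 := by
      have : ‖e‖ ^ 2 = 1 := by
        rw [norm_add_sq_real, inner_smul_right, inner_smul_left, hvw, norm_smul, norm_smul, hv, hw,
          mul_one, mul_one, Real.norm_eq_abs, Real.norm_eq_abs, sq_abs, sq_abs, Real.sq_sqrt hs]
        simp
      exact (pow_eq_one_iff_of_nonneg (norm_nonneg _) two_ne_zero).1 this
    refine measure_pos_of_fourierIntegral_eq_cos hcos hν he ?_ hc0 hc1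
    rw [inner_add_right, inner_smul_right, inner_smul_right, hvw, real_inner_self_eq_norm_sq, hv]
    simp
  have hcount := Measure.countable_meas_pos_of_disjoint_iUnion (μ := ν) hAm hdisj
  rw [Set.eq_univ_of_forall (s := {c | 0 < ν (A c)}) hpos, Set.countable_univ_iff,
    Set.countable_coe_iff] at hcount
  exact (Cardinal.Real.Ioo_countable_iff.1 hcount).not_gt zero_lt_one

end Sjostrand

theorem mainTheorem12 (d : ℕ) (hd : 1 ≤ d) (ħ : ℝ) (hħ : 0 < ħ) :
    Sjostrand.cosNorm d ∈ Sjostrand.CbInfty d ∧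
    Sjostrand.toDistribution '' Sjostrand.CbInfty d ⊆ Sjostrand.sjostrandClass ħ d ∧
    (1 < d →
      Sjostrand.cosNorm d ∉ Sjostrand.FM d ∧
      Sjostrand.toDistribution '' Sjostrand.FM d ⊂ Sjostrand.sjostrandClass ħ d) := by
  refine ⟨Sjostrand.cosNorm_mem_CbInfty d, Sjostrand.toDistribution_CbInfty_subset hħ, fun h => ?_⟩
  have hnot := Sjostrand.cosNorm_notMem_FM h
  refine ⟨hnot, Sjostrand.toDistribution_FM_subset hħ, fun hsub => ?_⟩
  obtain ⟨f, hf, heq⟩ := hsub (Sjostrand.toDistribution_CbInfty_subset hħ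
    ⟨_, Sjostrand.cosNorm_mem_CbInfty d, rfl⟩)
  exact hnot (Sjostrand.toDistribution_injective heq ▸ hf)
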